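/- Let $(R,\mathfrak m)$ be a commutative Noetherian complete local domain of Krull dimension $d$, and let $\Lambda$ be a (not necessarily commutative) associative unital $R$-algebra that is finitely generated and torsion-free as an $R$-module. Let $\mathfrak j$ be the Jacobson radical of $\Lambda$ and $\mathrm{proj}(\Lambda)$ the category of finitely generated projective left $\Lambda$-modules. Let $\Phi:\mathrm{proj}(\Lambda)\to\mathrm{proj}(\Lambda)$ be a functor such that (a) $\Phi$ is exact: it sends every sequence in $\mathrm{proj}(\Lambda)$ that is exact as a sequence of $\Lambda$-modules to an exact sequence; (b) $\Phi$ is order-raising: for every $i>0$ there is $e_0>0$ such that for every $e\ge e_0$ and every morphism $f:P\to Q$ of $\mathrm{proj}(\Lambda)$ with $f(P)\subseteq\mathfrak jQ$, the iterate $\Phi^e$ satisfies $\Phi^e(f)\bigl(\Phi^e(P)\bigr)\subseteq\mathfrak j^i\,\Phi^e(Q)$; (c) $\Phi$ has zero kernel: if $\Phi(N)\cong 0$, then $N\cong 0$. Then $\Lambda$ has finite (left) global dimension, that is, there is a uniform finite bound on the projective dimensions of left $\Lambda$-modules. If moreover $\Lambda$ is nonzero and maximal Cohen–Macaulay as an $R$-module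 (that is, $\mathfrak m$ contains a $\Lambda$-regular sequence of length $d$), then $\operatorname{gldim}\Lambda=d$. -/

import Mathlib

open CategoryTheory

universe u v

/-- The property of being a finitely generated projective left `Λ`-module. -/
def isFGProjective (Λ : Type v) [Ring Λ] : ObjectProperty (ModuleCat.{v} Λ) :=
  fun M => Module.Finite Λ M ∧ Module.Projective Λ M

/-- The category `proj(Λ)` of finitely generated projective left `Λ`-modules. -/
abbrev FGProj (Λ : Type v) [Ring Λ] : Type (v + 1) :=
  (isFGProjective Λ).FullSubcategory

/-- The `Λ`-linear map underlying a morphism of `proj(Λ)`. -/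
abbrev FGProj.linearMap {Λ : Type v} [Ring Λ] {P Q : FGProj Λ} (f : P ⟶ Q) :
    P.obj →ₗ[Λ] Q.obj :=
  f.hom.hom

/-- The `e`-fold iterate `Φ^e` of an endofunctor. -/
def functorIterate {C : Type u} [Category.{v} C] (Φ : C ⥤ C) : ℕ → (C ⥤ C)
  | 0 => 𝟭 C
  | e + 1 => functorIterate Φ e ⋙ Φ

/-- An endofunctor of `proj(Λ)` is exact if it preserves exact sequences, exactness being
understood in the category of all modules. A sequence of any length is exact when each of its
three-term pieces is exact in the middle, so three-term sequences suffice. (Such a functor is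
automatically additive.) -/
def IsExactEndofunctor {Λ : Type v} [Ring Λ] (Φ : FGProj Λ ⥤ FGProj Λ) : Prop :=
  ∀ ⦃P Q T : FGProj Λ⦄ (f : P ⟶ Q) (g : Q ⟶ T),
    Function.Exact (FGProj.linearMap f) (FGProj.linearMap g) →
      Function.Exact (FGProj.linearMap (Φ.map f)) (FGProj.linearMap (Φ.map g))

/-- `f : P ⟶ Q` factors through the submodule `𝔧^i Q`, where `𝔧` is the Jacobson radical. -/
def FactorsThroughRadicalPow {Λ : Type v} [Ring Λ] (i : ℕ) {P Q : FGProj Λ} (f : P ⟶ Q) : Prop :=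
  LinearMap.range (FGProj.linearMap f) ≤ (Ring.jacobson Λ) ^ i • (⊤ : Submodule Λ Q.obj)

/-- For every `i > 0` there is `e₀ > 0` such that for all `e ≥ e₀`, the functor `Φ^e` sends
every `f : P ⟶ Q` that factors through `𝔧 Q` to a morphism that factors through `𝔧^i Φ^e(Q)`. -/
def IsOrderRaising {Λ : Type v} [Ring Λ] (Φ : FGProj Λ ⥤ FGProj Λ) : Prop :=
  ∀ i : ℕ, 0 < i → ∃ e₀ : ℕ, 0 < e₀ ∧ ∀ e : ℕ, e₀ ≤ e →
    ∀ ⦃P Q : FGProj Λ⦄ (f : P ⟶ Q), FactorsThroughRadicalPow 1 f →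
      FactorsThroughRadicalPow i ((functorIterate Φ e).map f)

/-- `Φ(N) ≅ 0` implies `N ≅ 0`. -/
def HasZeroKernel {Λ : Type v} [Ring Λ] (Φ : FGProj Λ ⥤ FGProj Λ) : Prop :=
  ∀ N : FGProj Λ, Limits.IsZero (Φ.obj N) → Limits.IsZero N

/-- The (left) global dimension: the supremum of the projective dimensions of all left
modules (`⊥` for the zero ring, `⊤` if it is infinite). -/
noncomputable def globalDimension (Λ : Type v) [Ring Λ] : WithBot ℕ∞ :=
  ⨆ M : ModuleCat.{v} Λ, projectiveDimension M

/-- A (finitely generated) module `M` over a Noetherian local ring `R` is (nonzero) maximal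
Cohen-Macaulay if its depth is `dim R`: the maximal ideal contains an `M`-regular sequence of
length `dim R`. `IsRegular` includes `M ≠ (x₁, …, x_d) M`, hence `M ≠ 0`. -/
def IsMaximalCohenMacaulay (R : Type u) [CommRing R] [IsLocalRing R]
    (M : Type v) [AddCommGroup M] [Module R M] : Prop :=
  ∃ rs : List R, (∀ r ∈ rs, r ∈ IsLocalRing.maximalIdeal R) ∧
    RingTheory.Sequence.IsRegular M rs ∧ ((rs.length : ℕ∞) : WithBot ℕ∞) = ringKrullDim R

/-! A finitely generated module `M` has a minimal projective resolution `P`, because projective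
covers exist over `Λ` (`exists_projectiveCover`). A large iterate `Φ^e` keeps it exact in positive
degrees and pushes its differentials into `𝔪^c`; since `Φ` has zero kernel, it suffices that the new
complex `Q` vanishes in high degrees, with a bound independent of `M`.

This is `exists_uniform_vanishing`. Choose successively elements of `𝔪` that are regular on `Λ / I_s
Λ` up to `𝔪`-power torsion, where `I_s` is generated by the earlier ones. By Artin–Rees this torsion
meets `𝔪^c` trivially, so differentials in `𝔪^c` make each element regular on `Q_n / I_s Q_n` in
high degrees, and exactness survives modulo the next ideal. The chain `I_s` stabilises; then the
next element is both zero and regular, so Nakayama gives `Q_n = 0`. Baer's criterion and dimension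
shifting pass from finitely generated modules to all modules.

In the Cohen–Macaulay case a regular sequence of length `d` replaces these elements and the bound
sharpens to `d`. Conversely, `Λ / (x₁, …, x_d) Λ` has projective dimension at least `d`, by a
Rees-type vanishing of Ext. -/

open IsLocalRing Abelian

/-! ### Completeness, Fitting idempotents and projective covers -/

/-- A finitely generated module over an `I`-adically complete ring is `I`-adically precomplete. -/
theorem IsPrecomplete.of_finite {R : Type*} [CommRing R] (I : Ideal R) [IsPrecomplete I R]
    (M : Type*) [AddCommGroup M] [Module R M] [Module.Finite R M] : IsPrecomplete I M := by
  obtain ⟨k, p, hp⟩ := Module.Finite.exists_fin' R M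
  refine ⟨fun f hf => ?_⟩
  -- Arbitrary lifts of a Cauchy sequence need not be Cauchy; lifting its differences into `I ^ n`
  -- and summing them gives one that is.
  have key : ∀ n, ∃ g : Fin k → R, (∀ i, g i ∈ I ^ n) ∧ p g = f (n + 1) - f n := by
    intro n
    have h1 : f (n + 1) - f n ∈ (I ^ n • ⊤ : Submodule R M) :=
      (SModEq.sub_mem.mp (hf (Nat.le_succ n)).symm)
    rw [← LinearMap.range_eq_top.mpr hp, ← Submodule.map_top, ← Submodule.map_smul''] at h1
    obtain ⟨g, hg, hg'⟩ := h1
    refine ⟨g, fun i => ?_, hg'⟩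
    have h2 := Submodule.smul_top_le_comap_smul_top (I ^ n)
      (LinearMap.proj (R := R) (φ := fun _ : Fin k => R) i) hg
    rwa [Submodule.mem_comap, LinearMap.proj_apply, smul_eq_mul, Ideal.mul_top] at h2
  choose g hg hpg using key
  obtain ⟨x0, hx0⟩ := hp (f 0)
  let G : ℕ → Fin k → R := fun n => x0 + ∑ i ∈ Finset.range n, g i
  have hG : ∀ n, p (G n) = f n := by
    intro n
    simp only [G, map_add, map_sum, hpg, hx0, Finset.sum_range_sub]
    abel
  have hcauchy : ∀ j {m n : ℕ}, m ≤ n → G m j ≡ G n j [SMOD (I ^ m • ⊤ : Submodule R R)] := by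
    intro j m n hmn
    refine SModEq.symm (SModEq.sub_mem.mpr ?_)
    have : G n j - G m j = ∑ i ∈ Finset.Ico m n, g i j := by
      rw [Finset.sum_Ico_eq_sub _ hmn]; simp [G]
    rw [this, smul_eq_mul, Ideal.mul_top]
    exact Ideal.sum_mem _ fun i hi => Ideal.pow_le_pow_right (Finset.mem_Ico.mp hi).1 (hg i j)
  choose L hL using fun j => IsPrecomplete.prec' (I := I) (fun n => G n j) (hcauchy j)
  refine ⟨p L, fun n => ?_⟩
  rw [← hG n]
  refine SModEq.sub_mem.mpr ?_
  rw [← map_sub, pi_eq_sum_univ' (G n - L), map_sum]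
  refine Submodule.sum_mem _ fun j _ => ?_
  rw [map_smul]
  refine Submodule.smul_mem_smul ?_ trivial
  have := SModEq.sub_mem.mp (hL j n)
  rwa [smul_eq_mul, Ideal.mul_top] at this

theorem IsAdicComplete.map_of_finite {R A : Type*} [CommRing R] [IsNoetherianRing R]
    [IsLocalRing R] [IsAdicComplete (IsLocalRing.maximalIdeal R) R] [CommRing A] [Algebra R A]
    [Module.Finite R A] :
    IsAdicComplete ((IsLocalRing.maximalIdeal R).map (algebraMap R A)) A := by
  set m := IsLocalRing.maximalIdeal R
  have hmem : ∀ n (x : A), x ∈ ((m.map (algebraMap R A)) ^ n • ⊤ : Submodule A A) ↔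
      x ∈ (m ^ n • ⊤ : Submodule R A) := by
    intro n x
    rw [smul_eq_mul, Ideal.mul_top, ← Ideal.map_pow, Ideal.smul_top_eq_map]
    rfl
  have hp := IsPrecomplete.of_finite m A
  have hh : IsHausdorff m A := IsHausdorff.of_isLocalRing m A (Ideal.IsPrime.ne_top inferInstance)
  refine { haus' := fun x hx => ?_, prec' := fun f hf => ?_ }
  · refine hh.haus' x fun n => ?_
    have := hx n
    rw [SModEq.zero] at this ⊢
    exact (hmem n x).mp this
  · obtain ⟨L, hL⟩ := hp.prec' f fun {a b} hab => by
      have := hf hab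
      rw [SModEq.sub_mem] at this ⊢
      exact (hmem _ _).mp this
    refine ⟨L, fun n => ?_⟩
    have := hL n
    rw [SModEq.sub_mem] at this ⊢
    exact (hmem _ _).mpr this

theorem isArtinian_quotient_smul_top {R : Type*} [CommRing R] [IsLocalRing R]
    (M : Type*) [AddCommGroup M] [Module R M] [Module.Finite R M] :
    IsArtinian R (M ⧸ (IsLocalRing.maximalIdeal R • ⊤ : Submodule R M)) := by
  let _ : Field (R ⧸ IsLocalRing.maximalIdeal R) := Ideal.Quotient.field _
  have : Module.Finite (R ⧸ IsLocalRing.maximalIdeal R)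
      (M ⧸ (IsLocalRing.maximalIdeal R • ⊤ : Submodule R M)) :=
    Module.Finite.of_restrictScalars_finite R _ _
  have h : IsArtinian (R ⧸ IsLocalRing.maximalIdeal R)
    (M ⧸ (IsLocalRing.maximalIdeal R • ⊤ : Submodule R M)) := inferInstance
  exact isArtinian_of_surjective_algebraMap (R := R ⧸ IsLocalRing.maximalIdeal R)
    Ideal.Quotient.mk_surjective

/-- Idempotents modulo an ideal lift in a commutative ring complete for that ideal. -/
theorem exists_isIdempotentElem_sub_mem {A : Type*} [CommRing A] (J : Ideal A) [HenselianRing A J]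
    (w : A) (hw : w * w - w ∈ J) : ∃ e : A, e * e = e ∧ e - w ∈ J := by
  have hmonic : (Polynomial.X ^ 2 - Polynomial.X : Polynomial A).Monic := by
    nontriviality A
    refine Polynomial.Monic.sub_of_left (Polynomial.monic_X_pow 2) ?_
    rw [Polynomial.degree_X, Polynomial.degree_X_pow]
    norm_num
  have hroot : (Polynomial.X ^ 2 - Polynomial.X : Polynomial A).eval w ∈ J := by
    simpa [sq] using hw
  have hder : (Polynomial.derivative (Polynomial.X ^ 2 - Polynomial.X : Polynomial A)).eval w
      = 2 * w - 1 := by simp; ring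
  -- Modulo `J` the derivative `2w - 1` squares to `1`, so `w` is a simple root of `X² - X` and
  -- Hensel's lemma applies.
  have hunit : IsUnit (Ideal.Quotient.mk J ((Polynomial.derivative
      (Polynomial.X ^ 2 - Polynomial.X : Polynomial A)).eval w)) := by
    rw [hder]
    refine IsUnit.of_mul_eq_one (Ideal.Quotient.mk J (2 * w - 1)) ?_
    have h2 : (2 * w - 1) * (2 * w - 1) = 4 * (w * w - w) + 1 := by ring
    rw [← map_mul, h2, map_add, map_mul _ _ (w * w - w), Ideal.Quotient.eq_zero_iff_mem.mpr hw,
      mul_zero, zero_add, map_one]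
  obtain ⟨e, he, hew⟩ := HenselianRing.is_henselian (I := J) _ hmonic w hroot hunit
  have : e ^ 2 - e = 0 := by simpa [Polynomial.IsRoot.def] using he
  exact ⟨e, by linear_combination this, hew⟩

/-- Fitting's lemma in a commutative finite algebra over a complete local ring. -/
theorem exists_isIdempotentElem_fitting (R : Type*) {A : Type*} [CommRing R] [IsNoetherianRing R]
    [IsLocalRing R] [IsAdicComplete (IsLocalRing.maximalIdeal R) R] [CommRing A] [Algebra R A]
    [Module.Finite R A] (a : A) :
    ∃ (e b : A) (n : ℕ), e * e = e ∧
      a ^ n - e * a ^ n ∈ (IsLocalRing.maximalIdeal R • ⊤ : Submodule R A) ∧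
      e - a * b ∈ (IsLocalRing.maximalIdeal R • ⊤ : Submodule R A) := by
  set J := (IsLocalRing.maximalIdeal R).map (algebraMap R A) with hJ
  have hmem : ∀ x : A, x ∈ (IsLocalRing.maximalIdeal R • ⊤ : Submodule R A) ↔ x ∈ J := by
    intro x
    rw [Ideal.smul_top_eq_map]; rfl
  simp only [hmem]
  have : IsAdicComplete J A := IsAdicComplete.map_of_finite
  have art : IsArtinianRing (A ⧸ J) := by
    have := isArtinian_quotient_smul_top (R := R) A
    rw [Ideal.smul_top_eq_map] at this
    exact isArtinian_of_tower R (M := A ⧸ J) this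
  obtain ⟨n, y, hy⟩ := IsArtinian.exists_pow_succ_smul_dvd (Ideal.Quotient.mk J a) (1 : A ⧸ J)
  obtain ⟨y, rfl⟩ := Ideal.Quotient.mk_surjective y
  have hy1 : Ideal.Quotient.mk J (a ^ (n + 1) * y) = Ideal.Quotient.mk J (a ^ n) := by
    simpa using hy
  have hpow : ∀ j, Ideal.Quotient.mk J (a ^ (n + j) * y ^ j) = Ideal.Quotient.mk J (a ^ n) := by
    intro j
    induction j with
    | zero => simp
    | succ j ih =>
      rw [← ih]
      have : a ^ (n + (j + 1)) * y ^ (j + 1) = (a ^ (n + 1) * y) * (a ^ j * y ^ j) := by ring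
      rw [this, map_mul, hy1, ← map_mul]
      congr 1; ring
  -- The exponent `n + 1` makes `w` divisible by `a` even when `n = 0`.
  set w := a ^ (n + 1) * y ^ (n + 1) with hw
  have hw2 : Ideal.Quotient.mk J (w * w) = Ideal.Quotient.mk J w := by
    have : w * w = (a ^ (n + (n + 1)) * y ^ (n + 1)) * (a * y ^ (n + 1)) := by rw [hw]; ring
    rw [this, map_mul, hpow, ← map_mul]
    congr 1; rw [hw]; ring
  have hwn : Ideal.Quotient.mk J (w * a ^ n) = Ideal.Quotient.mk J (a ^ n) := by
    rw [← hpow (n + 1)]; congr 1; rw [hw]; ring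
  obtain ⟨e, he', hew⟩ := exists_isIdempotentElem_sub_mem J w (Ideal.Quotient.eq.mp hw2)
  refine ⟨e, a ^ n * y ^ (n + 1), n, he', ?_, ?_⟩
  · rw [← Ideal.Quotient.eq] at hew ⊢
    rw [map_mul, hew, ← map_mul, hwn]
  · have : a * (a ^ n * y ^ (n + 1)) = w := by rw [hw]; ring
    rwa [this]

/-- The radical of a projective module `Q` is `𝔧 Q`. -/
theorem Module.jacobson_eq_jacobson_smul_top {Λ Q : Type*} [Ring Λ] [AddCommGroup Q] [Module Λ Q]
    [Module.Projective Λ Q] : Module.jacobson Λ Q = Ring.jacobson Λ • (⊤ : Submodule Λ Q) := by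
  refine le_antisymm (fun z hz => ?_) (Ring.jacobson_smul_top_le Λ Q)
  obtain ⟨s, hs⟩ := Module.projective_def'.mp (inferInstance : Module.Projective Λ Q)
  have hz' := LinearMap.congr_fun hs z
  rw [LinearMap.comp_apply, Finsupp.linearCombination_apply, LinearMap.id_apply] at hz'
  rw [← hz']
  refine Submodule.sum_mem _ fun q _ => Submodule.smul_mem_smul ?_ trivial
  exact Module.le_comap_jacobson ((Finsupp.lapply q).comp s) hz

theorem exists_isCoatom_not_le_of_not_le_jacobson {Λ Q : Type*} [Ring Λ] [AddCommGroup Q]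
    [Module Λ Q] {K : Submodule Λ Q} (hK : ¬ K ≤ Module.jacobson Λ Q) :
    ∃ L : Submodule Λ Q, IsCoatom L ∧ K ⊔ L = ⊤ := by
  rw [Module.jacobson, le_sInf_iff] at hK
  push Not at hK
  obtain ⟨L, hL, hKL⟩ := hK
  exact ⟨L, hL, by rw [sup_comm]; exact hL.2 _ (left_lt_sup.mpr hKL)⟩

/-- Fitting's lemma for an element of a finite algebra over a complete local ring. -/
theorem exists_isIdempotentElem_fitting_of_finite (R : Type*) {E : Type*} [CommRing R]
    [IsNoetherianRing R] [IsLocalRing R] [IsAdicComplete (IsLocalRing.maximalIdeal R) R] [Ring E]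
    [Algebra R E] [Module.Finite R E] (a : E) :
    ∃ (e b : E) (n : ℕ), e * e = e ∧
      a ^ n - e * a ^ n ∈ (IsLocalRing.maximalIdeal R • ⊤ : Submodule R E) ∧
      e - a * b ∈ (IsLocalRing.maximalIdeal R • ⊤ : Submodule R E) := by
  let A := Algebra.adjoin R {a}
  have : IsMulCommutative A := Algebra.isMulCommutative_adjoin R (by simp)
  have : Module.Finite R A := inferInstanceAs (Module.Finite R (Subalgebra.toSubmodule A))
  obtain ⟨e, b, n, he, h1, h2⟩ :=
    exists_isIdempotentElem_fitting R (⟨a, Algebra.self_mem_adjoin_singleton R a⟩ : A)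
  have hle := Submodule.smul_top_le_comap_smul_top (IsLocalRing.maximalIdeal R) A.val.toLinearMap
  exact ⟨e, b, n, congrArg Subtype.val he, hle h1, hle h2⟩

theorem LinearMap.apply_mem_smul_top {R Λ Q N : Type*} [CommRing R] [Ring Λ] [Algebra R Λ]
    [AddCommGroup Q] [Module R Q] [Module Λ Q] [IsScalarTower R Λ Q]
    [AddCommGroup N] [Module R N] [Module Λ N] [IsScalarTower R Λ N] (I : Ideal R)
    (f : Q →ₗ[Λ] N) {z : Q} (hz : z ∈ (I • ⊤ : Submodule R Q)) :
    f z ∈ (I • ⊤ : Submodule R N) :=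
  Submodule.smul_top_le_comap_smul_top I (f.restrictScalars R) hz

theorem Module.End.apply_mem_smul_top {R Λ Q : Type*} [CommRing R] [Ring Λ] [Algebra R Λ]
    [AddCommGroup Q] [Module R Q] [Module Λ Q] [IsScalarTower R Λ Q] (I : Ideal R)
    {f : Module.End Λ Q} (hf : f ∈ (I • ⊤ : Submodule R (Module.End Λ Q))) (z : Q) :
    f z ∈ (I • ⊤ : Submodule R Q) := by
  induction hf using Submodule.smul_induction_on' with
  | smul r hr g _ => exact Submodule.smul_mem_smul hr trivial
  | add f _ g _ hf hg => exact Submodule.add_mem _ hf hg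

theorem Module.End.finite_of_finite (R Λ Q : Type*) [CommRing R] [IsNoetherianRing R] [Ring Λ]
    [Algebra R Λ] [AddCommGroup Q] [Module R Q] [Module Λ Q] [IsScalarTower R Λ Q]
    [Module.Finite R Q] : Module.Finite R (Module.End Λ Q) := by
  let f : Module.End Λ Q →ₗ[R] (Q →ₗ[R] Q) :=
    { toFun := fun g => g.restrictScalars R, map_add' := fun _ _ => rfl, map_smul' := fun _ _ => rfl }
  exact Module.Finite.of_injective f (LinearMap.restrictScalars_injective R)

theorem LinearMap.surjective_of_sup_smul_top {R M N : Type*} [CommRing R] [IsLocalRing R]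
    [AddCommGroup M] [Module R M] [AddCommGroup N] [Module R N] [Module.Finite R N]
    (f : M →ₗ[R] N)
    (h : ∀ z, ∃ w, z - f w ∈ (IsLocalRing.maximalIdeal R • ⊤ : Submodule R N)) :
    Function.Surjective f := by
  rw [← LinearMap.range_eq_top, eq_top_iff]
  refine Submodule.le_of_le_smul_of_le_jacobson_bot Module.Finite.fg_top
    (IsLocalRing.maximalIdeal_le_jacobson ⊥) fun z _ => ?_
  obtain ⟨w, hw⟩ := h z
  rw [← add_sub_cancel (f w) z]
  exact Submodule.add_mem_sup ⟨w, rfl⟩ hw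

/-- Finitely generated modules over a finite algebra over a complete Noetherian local ring have
projective covers. -/
theorem exists_projectiveCover (R : Type*) {Λ : Type v} [CommRing R] [IsNoetherianRing R]
    [IsLocalRing R] [IsAdicComplete (IsLocalRing.maximalIdeal R) R] [Ring Λ] [Algebra R Λ]
    [Module.Finite R Λ] (M : Type*) [AddCommGroup M] [Module R M] [Module Λ M]
    [IsScalarTower R Λ M] [Module.Finite Λ M] :
    ∃ (n : ℕ) (C : Submodule Λ (Fin n → Λ)) (g : ((Fin n → Λ) ⧸ C) →ₗ[Λ] M),
      Module.Projective Λ ((Fin n → Λ) ⧸ C) ∧ Function.Surjective g ∧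
      LinearMap.ker g ≤ Ring.jacobson Λ • ⊤ := by
  have : IsNoetherianRing Λ := isNoetherian_of_tower R inferInstance
  have : Module.Finite R M := Module.Finite.trans Λ M
  obtain ⟨n, p, hp⟩ := Module.Finite.exists_fin' Λ M
  let S : Set (Submodule Λ (Fin n → Λ)) := {C | Module.Projective Λ ((Fin n → Λ) ⧸ C) ∧
    ∃ g : ((Fin n → Λ) ⧸ C) →ₗ[Λ] M, Function.Surjective g}
  have hS : S.Nonempty := by
    refine ⟨⊥, Module.Projective.of_equiv (Submodule.quotEquivOfEqBot ⊥ rfl).symm,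
      p.comp (Submodule.quotEquivOfEqBot ⊥ rfl).toLinearMap, ?_⟩
    exact hp.comp (LinearEquiv.surjective _)
  -- A maximal `C` makes the projective `Λ^n / C` as small as possible. If `ker g` were not in the
  -- radical, `g` would lift through a maximal submodule `L` to an endomorphism `φ` with `g φ = g`.
  -- The range of its Fitting idempotent `e` is again projective and maps onto `M`, so maximality
  -- forces `e = 1`; then `φ` is surjective, although its image lies in `L`.
  obtain ⟨C, ⟨hproj, g, hg⟩, hmax⟩ := set_has_maximal_iff_noetherian.mpr
    (inferInstance : IsNoetherian Λ (Fin n → Λ)) S hS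
  refine ⟨n, C, g, hproj, hg, ?_⟩
  rw [← Module.jacobson_eq_jacobson_smul_top]
  by_contra hK
  obtain ⟨L, hL, hKL⟩ := exists_isCoatom_not_le_of_not_le_jacobson hK
  have hgL : Function.Surjective (g.comp L.subtype) := by
    intro y
    obtain ⟨z, rfl⟩ := hg y
    obtain ⟨k, hk, l, hl, rfl⟩ := Submodule.mem_sup.mp (hKL ▸ Submodule.mem_top : z ∈ _ ⊔ L)
    exact ⟨⟨l, hl⟩, by simp [LinearMap.mem_ker.mp hk]⟩
  obtain ⟨φ', hφ'⟩ := Module.projective_lifting_property (g.comp L.subtype) g hgL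
  let φ : Module.End Λ ((Fin n → Λ) ⧸ C) := L.subtype.comp φ'
  have hgφ : ∀ z, g (φ z) = g z := fun z => LinearMap.congr_fun hφ' z
  have hgφn : ∀ k z, g ((φ ^ k) z) = g z := by
    intro k
    induction k with
    | zero => simp
    | succ k ih => intro z; rw [pow_succ', Module.End.mul_apply, hgφ, ih]
  have := Module.End.finite_of_finite R Λ ((Fin n → Λ) ⧸ C)
  obtain ⟨e, b, k, he, h1, h2⟩ := exists_isIdempotentElem_fitting_of_finite R φ
  have hge : Function.Surjective (g.comp e) := by
    refine LinearMap.surjective_of_sup_smul_top ((g.comp e).restrictScalars R) fun y => ?_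
    obtain ⟨z, rfl⟩ := hg y
    refine ⟨(φ ^ k) z, ?_⟩
    have := LinearMap.apply_mem_smul_top _ g (Module.End.apply_mem_smul_top _ h1 z)
    simpa [hgφn] using this
  let D := LinearMap.ker (e.rangeRestrict.comp C.mkQ)
  let ε : ((Fin n → Λ) ⧸ D) ≃ₗ[Λ] LinearMap.range e :=
    LinearMap.quotKerEquivOfSurjective (e.rangeRestrict.comp C.mkQ)
      (e.surjective_rangeRestrict.comp C.mkQ_surjective)
  have hD : D ∈ S := by
    have : Module.Projective Λ (LinearMap.range e) := by
      refine Module.Projective.of_split (LinearMap.range e).subtype e.rangeRestrict ?_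
      ext ⟨_, z, rfl⟩
      exact LinearMap.congr_fun he z
    refine ⟨Module.Projective.of_equiv ε.symm,
      (g.comp (LinearMap.range e).subtype).comp ε.toLinearMap, ?_⟩
    have h : Function.Surjective (g.comp (LinearMap.range e).subtype) := fun y => by
      obtain ⟨z, hz⟩ := hge y
      exact ⟨⟨e z, z, rfl⟩, hz⟩
    exact h.comp ε.surjective
  have hCD : C ≤ D := fun c hc => by
    have : C.mkQ c = 0 := (Submodule.Quotient.mk_eq_zero C).mpr hc
    simp only [D, LinearMap.mem_ker, LinearMap.comp_apply, this, map_zero]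
  have hDC : D = C := (eq_of_le_of_not_lt hCD (hmax D hD)).symm
  have hinj : Function.Injective e := by
    rw [injective_iff_map_eq_zero]
    intro z hz
    obtain ⟨c, rfl⟩ := C.mkQ_surjective z
    have : c ∈ D := Subtype.ext hz
    rw [hDC] at this
    exact (Submodule.Quotient.mk_eq_zero C).mpr this
  have he1 : ∀ z, e z = z := fun z => hinj (LinearMap.congr_fun he z)
  have hφsurj : Function.Surjective φ := by
    refine LinearMap.surjective_of_sup_smul_top (φ.restrictScalars R) fun y => ⟨b y, ?_⟩
    have := Module.End.apply_mem_smul_top _ h2 y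
    simpa [he1] using this
  refine hL.1 (eq_top_iff.mpr fun y _ => ?_)
  obtain ⟨z, rfl⟩ := hφsurj y
  exact (φ' z).2

/-! ### Regular and filter-regular elements -/

section transfer

variable {R Λ Q : Type*} [CommRing R] [Ring Λ] [Algebra R Λ] [AddCommGroup Q] [Module R Q]
  [Module Λ Q] [IsScalarTower R Λ Q] [Module.Projective Λ Q]

/-- By a dual basis `z = ∑ f_q(z) q`. This carries regularity properties of `Λ` modulo `I` over to
every projective module. -/
theorem mem_smul_top_of_forall_dual {I : Ideal R} {z : Q}
    (h : ∀ f : Q →ₗ[Λ] Λ, f z ∈ (I • ⊤ : Submodule R Λ)) : z ∈ (I • ⊤ : Submodule R Q) := by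
  obtain ⟨s, hs⟩ := Module.projective_def'.mp (inferInstance : Module.Projective Λ Q)
  have hz' := LinearMap.congr_fun hs z
  rw [LinearMap.comp_apply, Finsupp.linearCombination_apply, LinearMap.id_apply] at hz'
  rw [← hz']
  refine Submodule.sum_mem _ fun q _ => ?_
  exact LinearMap.apply_mem_smul_top I (LinearMap.toSpanSingleton Λ Q q)
    (h ((Finsupp.lapply q).comp s))

theorem mem_smul_top_of_smul_mem_of_projective {I : Ideal R} {x : R}
    (hx : ∀ z : Λ, x • z ∈ (I • ⊤ : Submodule R Λ) → z ∈ (I • ⊤ : Submodule R Λ)) {z : Q}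
    (hz : x • z ∈ (I • ⊤ : Submodule R Q)) : z ∈ (I • ⊤ : Submodule R Q) :=
  mem_smul_top_of_forall_dual fun f => hx _ (by
    rw [← LinearMap.map_smul_of_tower]; exact LinearMap.apply_mem_smul_top I f hz)

end transfer

/-- `x` is regular on `N / T` up to `I`-power torsion, and the `I`-power torsion of `N / T` is
bounded and meets the `I`-adic filtration trivially from some point on. -/
theorem exists_filterRegular (R : Type*) {N : Type*} [CommRing R] [IsNoetherianRing R]
    [IsLocalRing R] [AddCommGroup N] [Module R N] [Module.Finite R N] :
    ∃ x ∈ maximalIdeal R, ∃ k c : ℕ,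
      (∀ z : N, x • z = 0 → ∀ r ∈ maximalIdeal R ^ k, r • z = 0) ∧
      (∀ z : N, (∀ r ∈ maximalIdeal R ^ k, r • z = 0) →
        z ∈ (maximalIdeal R ^ c • ⊤ : Submodule R N) → z = 0) := by
  set m := maximalIdeal R with hm
  let T : ℕ →o Submodule R N :=
    { toFun := fun k => Submodule.torsionBySet R N (m ^ k : Ideal R)
      monotone' := fun a b hab => Submodule.torsionBySet_le_torsionBySet_of_subset
        (Ideal.pow_le_pow_right hab) }
  have hT : ∀ k z, z ∈ T k ↔ ∀ r ∈ m ^ k, r • z = 0 := fun k z => by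
    change z ∈ Submodule.torsionBySet R N (m ^ k : Ideal R) ↔ _
    simp [Submodule.mem_torsionBySet_iff]
  -- The stable `T k` is the whole `𝔪`-power torsion, so `𝔪` is not associated to `N / T k`, and
  -- prime avoidance finds an `x` in `𝔪` regular on it.
  obtain ⟨k, hk⟩ := monotone_stabilizes_iff_noetherian.mpr (inferInstance : IsNoetherian R N) T
  have hass : m ∉ associatedPrimes R (N ⧸ T k) := by
    rw [AssociatedPrimes.mem_iff, isAssociatedPrime_iff]
    rintro ⟨hp, y, hy⟩
    obtain ⟨y, rfl⟩ := Submodule.mkQ_surjective _ y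
    have hmy : ∀ r ∈ m, r • y ∈ T k := fun r hr => by
      rw [hy, Submodule.mem_colon_singleton, ← map_smul, Submodule.mem_bot] at hr
      exact (Submodule.Quotient.mk_eq_zero _).mp hr
    have hy' : y ∈ T (k + 1) := by
      rw [hT]
      intro r hr
      rw [pow_succ] at hr
      induction hr using Submodule.mul_induction_on' with
      | mem_mul_mem a ha b hb => rw [mul_smul]; exact (hT k _).mp (hmy b hb) a ha
      | add a _ b _ ha hb => rw [add_smul, ha, hb, add_zero]
    rw [← hk (k + 1) (Nat.le_succ k)] at hy'
    refine hp.ne_top (hy.trans ?_)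
    have : (T k).mkQ y = 0 := (Submodule.Quotient.mk_eq_zero _).mpr hy'
    rw [this, Ideal.eq_top_iff_one, Submodule.mem_colon_singleton, smul_zero]
    exact zero_mem _
  have hex : ∃ x ∈ m, ∀ z : N ⧸ T k, x • z = 0 → z = 0 := by
    by_contra! hcon
    have hsub : (m : Set R) ⊆ ⋃ p ∈ associatedPrimes R (N ⧸ T k), p := by
      rw [biUnion_associatedPrimes_eq_zero_divisors]
      intro x hx
      obtain ⟨z, h1, h2⟩ := hcon x hx
      exact ⟨z, h2, h1⟩
    obtain ⟨p, hp, hmp⟩ := (Ideal.subset_union_prime_finite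
      (associatedPrimes.finite R (N ⧸ T k)) (f := id) 0 0 fun _ h _ _ => h.1).1 hsub
    have : m = p := (IsLocalRing.maximalIdeal.isMaximal R).eq_of_le hp.1.ne_top hmp
    exact hass (this ▸ hp)
  obtain ⟨x, hxm, hx⟩ := hex
  -- Artin–Rees: `𝔪^(c+k) N ∩ T k = 𝔪^k (𝔪^c N ∩ T k)`, which is zero since `𝔪^k` kills `T k`.
  obtain ⟨c, hc⟩ := m.exists_pow_inf_eq_pow_smul (T k)
  refine ⟨x, hxm, k, c + k, fun z hz => ?_, fun z hz hzc => ?_⟩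
  · rw [← hT]
    refine (Submodule.Quotient.mk_eq_zero _).mp (hx (Submodule.Quotient.mk z) ?_)
    rw [← Submodule.Quotient.mk_smul, hz, Submodule.Quotient.mk_zero]
  · have h1 : z ∈ m ^ (c + k) • ⊤ ⊓ T k := ⟨hzc, (hT k z).mpr hz⟩
    rw [hc _ (Nat.le_add_right c k), Nat.add_sub_cancel_left] at h1
    have h2 : m ^ k • (m ^ c • ⊤ ⊓ T k) ≤ (⊥ : Submodule R N) :=
      Submodule.smul_le.mpr fun r hr y hy => (hT k y).mp hy.2 r hr
    exact h2 h1

/-- Relative form of `exists_filterRegular` for the quotient `N / I N`. -/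
theorem exists_filterRegular_smul_top {R : Type*} (N : Type*) [CommRing R] [IsNoetherianRing R]
    [IsLocalRing R] [AddCommGroup N] [Module R N] [Module.Finite R N] (I : Ideal R) :
    ∃ x ∈ maximalIdeal R, ∃ k c : ℕ,
      (∀ z : N, x • z ∈ (I • ⊤ : Submodule R N) →
        ∀ r ∈ maximalIdeal R ^ k, r • z ∈ (I • ⊤ : Submodule R N)) ∧
      (∀ z : N, (∀ r ∈ maximalIdeal R ^ k, r • z ∈ (I • ⊤ : Submodule R N)) →
        z ∈ (maximalIdeal R ^ c • ⊤ ⊔ I • ⊤ : Submodule R N) → z ∈ (I • ⊤ : Submodule R N)) := by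
  obtain ⟨x, hx, k, c, h1, h2⟩ := exists_filterRegular R (N := N ⧸ (I • ⊤ : Submodule R N))
  refine ⟨x, hx, k, c, fun z hz r hr => ?_, fun z hz hzc => ?_⟩
  · rw [← Submodule.Quotient.mk_eq_zero, Submodule.Quotient.mk_smul] at hz ⊢
    exact h1 _ hz r hr
  · rw [← Submodule.Quotient.mk_eq_zero]
    refine h2 _ (fun r hr => ?_) ?_
    · rw [← Submodule.Quotient.mk_smul, Submodule.Quotient.mk_eq_zero]
      exact hz r hr
    · obtain ⟨a, ha, b, hb, rfl⟩ := Submodule.mem_sup.mp hzc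
      rw [Submodule.Quotient.mk_add, (Submodule.Quotient.mk_eq_zero _).mpr hb, add_zero]
      exact Submodule.smul_top_le_comap_smul_top _ (Submodule.mkQ _) ha

/-! ### Complexes of projectives with differentials in a high power of `𝔪` -/

section complex

variable {R Λ : Type*} [CommRing R] [Ring Λ] [Algebra R Λ] {Q : ℕ → Type*}
  [∀ n, AddCommGroup (Q n)] [∀ n, Module R (Q n)] [∀ n, Module Λ (Q n)]
  [∀ n, IsScalarTower R Λ (Q n)]

/-- The complex `Q` is exact modulo `I` at `Q (n + 1)`. -/
def ExactModAt (f : ∀ n, Q (n + 1) →ₗ[Λ] Q n) (I : Ideal R) (n : ℕ) : Prop :=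
  ∀ z : Q (n + 1), f n z ∈ (I • ⊤ : Submodule R (Q n)) →
    ∃ w : Q (n + 2), z - f (n + 1) w ∈ (I • ⊤ : Submodule R (Q (n + 1)))

theorem mem_sup_span_singleton_smul_top_iff {M : Type*} [AddCommGroup M] [Module R M] {I : Ideal R}
    {x : R} {z : M} : z ∈ ((I ⊔ Ideal.span {x}) • ⊤ : Submodule R M) ↔
      ∃ w, z - x • w ∈ (I • ⊤ : Submodule R M) := by
  rw [Submodule.sup_smul, Submodule.ideal_span_singleton_smul, Submodule.mem_sup]
  constructor
  · rintro ⟨y, hy, _, ⟨w, -, rfl⟩, rfl⟩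
    exact ⟨w, by simpa using hy⟩
  · rintro ⟨w, hw⟩
    exact ⟨_, hw, x • w, Submodule.smul_mem_pointwise_smul _ _ _ trivial, by simp⟩

/-- If `f z ≡ x w` modulo `I`, then `x f(w) ≡ 0`, so `f(w) ≡ 0` by regularity and `w ≡ f(v)`. Hence
`z - x v` is a cycle modulo `I`, and so a boundary modulo `I`. -/
theorem ExactModAt.sup_span_singleton {f : ∀ n, Q (n + 1) →ₗ[Λ] Q n} (hf : ∀ n z, f n (f (n + 1) z) = 0)
    {I : Ideal R} {x : R} {n : ℕ}
    (h : ExactModAt f I n) (h' : ExactModAt f I (n + 1))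
    (hreg : ∀ z : Q n, x • z ∈ (I • ⊤ : Submodule R (Q n)) → z ∈ (I • ⊤ : Submodule R (Q n))) :
    ExactModAt f (I ⊔ Ideal.span {x}) (n + 1) := by
  intro z hz
  obtain ⟨w, hw⟩ := mem_sup_span_singleton_smul_top_iff.mp hz
  have h1 : f n w ∈ (I • ⊤ : Submodule R (Q n)) := by
    refine hreg _ ?_
    have := LinearMap.apply_mem_smul_top I (f n) hw
    rw [map_sub, hf, zero_sub, LinearMap.map_smul_of_tower] at this
    exact neg_mem_iff.mp this
  obtain ⟨v, hv⟩ := h w h1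
  have h2 : f (n + 1) (z - x • v) ∈ (I • ⊤ : Submodule R (Q (n + 1))) := by
    have : f (n + 1) (z - x • v) = (f (n + 1) z - x • w) + x • (w - f (n + 1) v) := by
      rw [map_sub, LinearMap.map_smul_of_tower, smul_sub]; abel
    rw [this]
    exact Submodule.add_mem _ hw (Submodule.smul_mem _ _ hv)
  obtain ⟨u, hu⟩ := h' _ h2
  refine ⟨u, mem_sup_span_singleton_smul_top_iff.mpr ⟨v, ?_⟩⟩
  rwa [sub_right_comm]

theorem subsingleton_of_le_smul_top [IsLocalRing R] {M : Type*} [AddCommGroup M] [Module R M]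
    [Module.Finite R M] {I : Ideal R} (hI : I ≤ maximalIdeal R)
    (h : ∀ z : M, z ∈ (I • ⊤ : Submodule R M)) : Subsingleton M := by
  have := Submodule.eq_bot_of_le_smul_of_le_jacobson_bot I (⊤ : Submodule R M)
    Module.Finite.fg_top (fun z _ => h z) (hI.trans (maximalIdeal_le_jacobson ⊥))
  exact (Submodule.subsingleton_iff R).mp ((subsingleton_iff_bot_eq_top).mp this.symm)

variable [IsLocalRing R] [∀ n, Module.Projective Λ (Q n)]

/-- If the differentials vanish modulo a high power of the maximal ideal, then a filter-regular
element is regular at every spot where the complex is exact. -/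
theorem ExactModAt.regular {f : ∀ n, Q (n + 1) →ₗ[Λ] Q n} {I : Ideal R} {x : R} {k c n : ℕ}
    (h1 : ∀ z : Λ, x • z ∈ (I • ⊤ : Submodule R Λ) →
        ∀ r ∈ maximalIdeal R ^ k, r • z ∈ (I • ⊤ : Submodule R Λ))
    (h2 : ∀ z : Λ, (∀ r ∈ maximalIdeal R ^ k, r • z ∈ (I • ⊤ : Submodule R Λ)) →
        z ∈ (maximalIdeal R ^ c • ⊤ ⊔ I • ⊤ : Submodule R Λ) → z ∈ (I • ⊤ : Submodule R Λ))
    (hf : ∀ n z, f n z ∈ (maximalIdeal R ^ c • ⊤ : Submodule R (Q n)))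
    (hex : ExactModAt f I n) {z : Q (n + 1)} (hz : x • z ∈ (I • ⊤ : Submodule R (Q (n + 1)))) :
    z ∈ (I • ⊤ : Submodule R (Q (n + 1))) := by
  have h1' : ∀ r ∈ maximalIdeal R ^ k, r • z ∈ (I • ⊤ : Submodule R (Q (n + 1))) := fun r hr =>
    mem_smul_top_of_forall_dual (Λ := Λ) fun g => by
      rw [LinearMap.map_smul_of_tower]
      refine h1 _ ?_ r hr
      rw [← LinearMap.map_smul_of_tower]
      exact LinearMap.apply_mem_smul_top I g hz
  have h2' : ∀ (l : ℕ) (y : Q l),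
      (∀ r ∈ maximalIdeal R ^ k, r • y ∈ (I • ⊤ : Submodule R (Q l))) →
      y ∈ ((maximalIdeal R ^ c ⊔ I) • ⊤ : Submodule R (Q l)) →
      y ∈ (I • ⊤ : Submodule R (Q l)) := fun l y hy hy' =>
    mem_smul_top_of_forall_dual (Λ := Λ) fun g => by
      refine h2 _ (fun r hr => ?_) ?_
      · rw [← LinearMap.map_smul_of_tower]
        exact LinearMap.apply_mem_smul_top I g (hy r hr)
      · rw [← Submodule.sup_smul]
        exact LinearMap.apply_mem_smul_top _ g hy'
  -- `f n z` is torsion modulo `I` and lies in `𝔪^c Q`, hence is zero modulo `I`. By exactness `z`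
  -- is a boundary modulo `I`, so it lies in `𝔪^c Q + I Q`, and the same argument applies to `z`
  -- itself.
  have h3 : f n z ∈ (I • ⊤ : Submodule R (Q n)) := by
    refine h2' n _ (fun r hr => ?_) ?_
    · rw [← LinearMap.map_smul_of_tower]
      exact LinearMap.apply_mem_smul_top I (f n) (h1' r hr)
    · exact Submodule.smul_mono_left le_sup_left (hf n z)
  obtain ⟨w, hw⟩ := hex z h3
  refine h2' _ z h1' ?_
  rw [← sub_add_cancel z (f (n + 1) w)]
  exact Submodule.add_mem _ (Submodule.smul_mono_left le_sup_right hw)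
    (Submodule.smul_mono_left le_sup_left (hf (n + 1) w))

end complex

/-- A complex of projective `Λ`-modules, exact in positive degrees, whose differentials
vanish modulo a large power of the maximal ideal, vanishes beyond a uniform bound. -/
theorem exists_uniform_vanishing (R Λ : Type*) [CommRing R] [IsNoetherianRing R] [IsLocalRing R]
    [Ring Λ] [Algebra R Λ] [Module.Finite R Λ] :
    ∃ c B : ℕ, ∀ (Q : ℕ → Type v) [∀ n, AddCommGroup (Q n)] [∀ n, Module R (Q n)]
      [∀ n, Module Λ (Q n)] [∀ n, IsScalarTower R Λ (Q n)] [∀ n, Module.Projective Λ (Q n)]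
      [∀ n, Module.Finite R (Q n)] (f : ∀ n, Q (n + 1) →ₗ[Λ] Q n),
      (∀ n, Function.Exact (f (n + 1)) (f n)) →
      (∀ n z, f n z ∈ (maximalIdeal R ^ c • ⊤ : Submodule R (Q n))) →
      ∀ n, B ≤ n → Subsingleton (Q n) := by
  choose x hxm k c h1 h2 using exists_filterRegular_smul_top (R := R) Λ
  -- These ideals depend on `R` and `Λ` only, not on the complex; hence the bounds are uniform.
  let I : ℕ → Ideal R := fun s => Nat.rec ⊥ (fun _ J => J ⊔ Ideal.span {x J}) s
  have hI0 : I 0 = ⊥ := rfl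
  have hIs : ∀ s, I (s + 1) = I s ⊔ Ideal.span {x (I s)} := fun s => rfl
  have hmono : Monotone I := monotone_nat_of_le_succ fun s => le_sup_left
  have hIm : ∀ s, I s ≤ maximalIdeal R := by
    intro s
    induction s with
    | zero => exact bot_le
    | succ s ih => exact sup_le ih ((Ideal.span_singleton_le_iff_mem _).mpr (hxm _))
  obtain ⟨S, hS⟩ := monotone_stabilizes_iff_noetherian.mpr (inferInstance : IsNoetherian R R)
    ⟨I, hmono⟩
  let C := (Finset.range (S + 1)).sup fun s => c (I s)
  refine ⟨C, 2 * S + 1, fun Q _ _ _ _ _ _ f hex hf => ?_⟩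
  have hfs : ∀ s ≤ S, ∀ n z, f n z ∈ (maximalIdeal R ^ c (I s) • ⊤ : Submodule R (Q n)) :=
    fun s hs n z => Submodule.smul_mono_left (Ideal.pow_le_pow_right
      (Finset.le_sup (f := fun s => c (I s)) (Finset.mem_range.mpr (Nat.lt_succ_of_le hs)))) (hf n z)
  -- Each new element costs two degrees: one because exactness moves up, one because regularity
  -- itself uses exactness one spot lower.
  have hE : ∀ s ≤ S, ∀ n, 2 * s ≤ n → ExactModAt f (I s) n := by
    intro s
    induction s with
    | zero =>
      intro _ n _ z hz
      rw [hI0, Submodule.bot_smul, Submodule.mem_bot] at hz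
      obtain ⟨w, rfl⟩ := (hex n z).mp hz
      exact ⟨w, by simp⟩
    | succ s ih =>
      intro hs n hn
      obtain ⟨n, rfl⟩ : ∃ l, n = l + 2 := ⟨n - 2, by omega⟩
      have ih' := ih (by omega)
      rw [hIs]
      refine ExactModAt.sup_span_singleton (fun n => (hex n).apply_apply_eq_zero)
        (ih' _ (by omega)) (ih' _ (by omega)) fun z hz => ?_
      exact ExactModAt.regular (h1 (I s)) (h2 (I s)) (hfs s (by omega)) (ih' n (by omega)) hz
  intro n hn
  obtain ⟨n, rfl⟩ : ∃ l, n = l + 1 := ⟨n - 1, by omega⟩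
  refine subsingleton_of_le_smul_top (hIm S) fun z => ?_
  refine ExactModAt.regular (h1 (I S)) (h2 (I S)) (hfs S le_rfl) (hE S le_rfl n (by omega))
    (Submodule.smul_mem_smul ?_ trivial)
  -- By stability `x (I S)` lies in `I S`, so multiplication by it is zero, as well as injective, on
  -- `Q / I_S Q`.
  have hIS : I S = I (S + 1) := hS (S + 1) (Nat.le_succ S)
  have h : x (I S) ∈ I (S + 1) := Ideal.mem_sup_right (Ideal.mem_span_singleton_self _)
  rwa [← hIS] at h

/-- A complex of projective `Λ`-modules, exact in positive degrees, whose differentials vanish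
modulo a large power of the maximal ideal, vanishes in degrees greater than the length of a
`Λ`-regular sequence that generates an ideal containing such a power. -/
theorem subsingleton_of_regular_of_pow_le {R Λ : Type*} [CommRing R] [IsLocalRing R]
    [Ring Λ] [Algebra R Λ] {d c : ℕ} {I : ℕ → Ideal R} {x : ℕ → R} (hI0 : I 0 = ⊥)
    (hIs : ∀ s < d, I (s + 1) = I s ⊔ Ideal.span {x s}) (hIm : I d ≤ maximalIdeal R)
    (hreg : ∀ s < d, ∀ z : Λ, x s • z ∈ (I s • ⊤ : Submodule R Λ) → z ∈ (I s • ⊤ : Submodule R Λ))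
    (hc : (maximalIdeal R ^ c • ⊤ : Submodule R Λ) ≤ I d • ⊤)
    {Q : ℕ → Type*} [∀ n, AddCommGroup (Q n)] [∀ n, Module R (Q n)]
    [∀ n, Module Λ (Q n)] [∀ n, IsScalarTower R Λ (Q n)] [∀ n, Module.Projective Λ (Q n)]
    [∀ n, Module.Finite R (Q n)] (f : ∀ n, Q (n + 1) →ₗ[Λ] Q n)
    (hex : ∀ n, Function.Exact (f (n + 1)) (f n))
    (hf : ∀ n z, f n z ∈ (maximalIdeal R ^ c • ⊤ : Submodule R (Q n)))
    (n : ℕ) (hn : d + 1 ≤ n) : Subsingleton (Q n) := by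
  -- Regularity on `Λ` passes to all projectives without using exactness, so each element costs only
  -- one degree.
  have hE : ∀ s ≤ d, ∀ n, s ≤ n → ExactModAt f (I s) n := by
    intro s
    induction s with
    | zero =>
      intro _ n _ z hz
      rw [hI0, Submodule.bot_smul, Submodule.mem_bot] at hz
      obtain ⟨w, rfl⟩ := (hex n z).mp hz
      exact ⟨w, by simp⟩
    | succ s ih =>
      intro hs n hn
      obtain ⟨n, rfl⟩ : ∃ l, n = l + 1 := ⟨n - 1, by omega⟩
      have ih' := ih (by omega)
      rw [hIs s (by omega)]
      exact ExactModAt.sup_span_singleton (fun n => (hex n).apply_apply_eq_zero)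
        (ih' _ (by omega)) (ih' _ (by omega)) fun z hz =>
          mem_smul_top_of_smul_mem_of_projective (hreg s (by omega)) hz
  have hf' : ∀ n z, f n z ∈ (I d • ⊤ : Submodule R (Q n)) := fun n z =>
    mem_smul_top_of_forall_dual (Λ := Λ) fun g => hc (LinearMap.apply_mem_smul_top _ g (hf n z))
  obtain ⟨n, rfl⟩ : ∃ l, n = l + 1 := ⟨n - 1, by omega⟩
  refine subsingleton_of_le_smul_top hIm fun z => ?_
  -- The differentials vanish modulo `I d`, so exactness there says `Q = I_d Q`.
  obtain ⟨w, hw⟩ := hE d le_rfl n (by omega) z (hf' n z)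
  rw [← sub_add_cancel z (f (n + 1) w)]
  exact Submodule.add_mem _ hw (hf' _ w)

/-! ### Powers of the radical against powers of `𝔪` -/

/-- `I Q`, as a `Λ`-submodule of `Q`, for an ideal `I` of the base ring of the algebra `Λ`. -/
def Ideal.smulTop {R : Type*} (Λ : Type*) [CommRing R] [Ring Λ] [Algebra R Λ] (I : Ideal R)
    (Q : Type*) [AddCommGroup Q] [Module R Q] [Module Λ Q] [IsScalarTower R Λ Q] :
    Submodule Λ Q where
  __ := (I • ⊤ : Submodule R Q).toAddSubmonoid
  smul_mem' a z hz := by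
    have := IsScalarTower.to_smulCommClass (R := R) (A := Λ) (M := Q)
    exact Submodule.smul_top_le_comap_smul_top I
      ({ toFun := fun z => a • z, map_add' := smul_add a,
         map_smul' := fun r z => smul_comm a r z } : Q →ₗ[R] Q) hz

theorem Ideal.mem_smulTop {R Λ : Type*} [CommRing R] [Ring Λ] [Algebra R Λ] {I : Ideal R}
    {Q : Type*} [AddCommGroup Q] [Module R Q] [Module Λ Q] [IsScalarTower R Λ Q] {z : Q} :
    z ∈ I.smulTop Λ Q ↔ z ∈ (I • ⊤ : Submodule R Q) := Iff.rfl

section radical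

variable (R : Type*) {Λ : Type*} [CommRing R] [IsNoetherianRing R] [IsLocalRing R] [Ring Λ]
  [Algebra R Λ] [Module.Finite R Λ]

/-- `Λ / 𝔪Λ` is Artinian, so its submodules `𝔧^i (Λ / 𝔪Λ)` stabilise; the stable one equals `𝔧`
times itself and vanishes by Nakayama. -/
theorem exists_jacobson_pow_le_smulTop :
    ∃ i, (Ring.jacobson Λ) ^ i ≤ (maximalIdeal R).smulTop Λ Λ := by
  have : IsNoetherianRing Λ := isNoetherian_of_tower R inferInstance
  let U := (maximalIdeal R).smulTop Λ Λ
  have : IsArtinian R (Λ ⧸ U) := by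
    have := isArtinian_quotient_smul_top (R := R) Λ
    have e : (Λ ⧸ (maximalIdeal R • ⊤ : Submodule R Λ)) ≃ₗ[R] (Λ ⧸ U) :=
      Submodule.Quotient.restrictScalarsEquiv R U
    exact isArtinian_of_linearEquiv e
  have : IsArtinian Λ (Λ ⧸ U) := isArtinian_of_tower R this
  let D : ℕ →o (Submodule Λ (Λ ⧸ U))ᵒᵈ :=
    { toFun := fun i => OrderDual.toDual ((Ring.jacobson Λ) ^ i • ⊤)
      monotone' := fun a b hab => Submodule.smul_mono_left (Ideal.pow_le_pow_right hab) }
  obtain ⟨i, hi⟩ := IsArtinian.monotone_stabilizes D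
  have h0 : (Ring.jacobson Λ) ^ i • (⊤ : Submodule Λ (Λ ⧸ U)) = ⊥ := by
    refine Submodule.FG.eq_bot_of_le_jacobson_smul (IsNoetherian.noetherian _) ?_
    have h1 : (Ring.jacobson Λ) ^ i • (⊤ : Submodule Λ (Λ ⧸ U)) = (Ring.jacobson Λ) ^ (i + 1) • ⊤ :=
      hi (i + 1) (Nat.le_succ i)
    have h2 : (Ring.jacobson Λ) ^ (i + 1) = Ring.jacobson Λ * (Ring.jacobson Λ) ^ i := by
      rw [add_comm, Ideal.IsTwoSided.pow_add, Submodule.pow_one]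
    rw [← Submodule.mul_smul, ← h2]
    exact le_of_eq h1
  refine ⟨i, fun a ha => ?_⟩
  have : a • U.mkQ 1 ∈ (Ring.jacobson Λ) ^ i • (⊤ : Submodule Λ (Λ ⧸ U)) :=
    Submodule.smul_mem_smul ha trivial
  rw [h0, Submodule.mem_bot, ← map_smul, smul_eq_mul, mul_one] at this
  exact (Submodule.Quotient.mk_eq_zero U).mp this

theorem exists_jacobson_pow_le_pow_smulTop (c : ℕ) :
    ∃ i, 0 < i ∧ (Ring.jacobson Λ) ^ i ≤ (maximalIdeal R ^ c).smulTop Λ Λ := by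
  obtain ⟨i, hi⟩ := exists_jacobson_pow_le_smulTop R (Λ := Λ)
  have key : ∀ c, (Ring.jacobson Λ) ^ (i * c) ≤ (maximalIdeal R ^ c).smulTop Λ Λ := by
    intro c
    induction c with
    | zero => intro a _; rw [Ideal.mem_smulTop]; simp
    | succ c ih =>
      rw [Nat.mul_succ, Ideal.IsTwoSided.pow_add]
      refine Ideal.mul_le.mpr fun a ha b hb => ?_
      have hb' : b ∈ (maximalIdeal R • ⊤ : Submodule R Λ) := hi hb
      clear hb
      rw [Ideal.mem_smulTop]
      induction hb' using Submodule.smul_induction_on' with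
      | smul r hr y _ =>
        have := Submodule.smul_mem_smul hr (LinearMap.apply_mem_smul_top _
          (LinearMap.toSpanSingleton Λ Λ y) (ih ha))
        rw [← Submodule.mul_smul, ← pow_succ'] at this
        simpa using this
      | add y _ y' _ hy hy' => rw [mul_add]; exact Submodule.add_mem _ hy hy'
  -- The extra `1` keeps the exponent positive, as order-raising demands.
  exact ⟨i * c + 1, Nat.succ_pos _, (Ideal.pow_le_pow_right (Nat.le_succ _)).trans (key c)⟩

end radical

theorem mem_smul_top_of_mem_jacobson_pow_smul_top {R Λ : Type*} [CommRing R] [Ring Λ] [Algebra R Λ]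
    {I : Ideal R} {i : ℕ}
    (h : (Ring.jacobson Λ) ^ i ≤ I.smulTop Λ Λ) {Q : Type*} [AddCommGroup Q] [Module R Q]
    [Module Λ Q] [IsScalarTower R Λ Q] {z : Q}
    (hz : z ∈ (Ring.jacobson Λ) ^ i • (⊤ : Submodule Λ Q)) : z ∈ (I • ⊤ : Submodule R Q) := by
  induction hz using Submodule.smul_induction_on' with
  | smul a ha q _ => exact LinearMap.apply_mem_smul_top I (LinearMap.toSpanSingleton Λ Q q) (h ha)
  | add y _ y' _ hy hy' => exact Submodule.add_mem _ hy hy'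

/-! ### Iterates of `Φ` and minimal complexes -/

section iterate

variable {Λ : Type v} [Ring Λ] {Φ : FGProj Λ ⥤ FGProj Λ}

theorem IsExactEndofunctor.iterate (h : IsExactEndofunctor Φ) (e : ℕ) :
    IsExactEndofunctor (functorIterate Φ e) := by
  induction e with
  | zero => exact fun P Q T f g hfg => hfg
  | succ e ih => exact fun P Q T f g hfg => h _ _ (ih f g hfg)

theorem HasZeroKernel.iterate (h : HasZeroKernel Φ) (e : ℕ) :
    HasZeroKernel (functorIterate Φ e) := by
  induction e with
  | zero => exact fun N hN => hN
  | succ e ih => exact fun N hN => ih _ (h _ hN)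

theorem FGProj.isZero_iff_subsingleton (P : FGProj Λ) :
    Limits.IsZero P ↔ Subsingleton P.obj := by
  constructor
  · intro h
    refine ⟨fun a b => ?_⟩
    have h1 : 𝟙 P = ObjectProperty.homMk 0 := h.eq_of_src _ _
    have h2 : ∀ z : P.obj, z = 0 := fun z =>
      congrArg (fun f : P ⟶ P => FGProj.linearMap f z) h1
    rw [h2 a, h2 b]
  · intro h
    have key : ∀ {X Y : FGProj Λ} (f g : X ⟶ Y), Limits.IsZero X.obj ∨ Limits.IsZero Y.obj →
        f = g := fun f g hXY => ObjectProperty.hom_ext _ (hXY.elim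
          (fun h => h.eq_of_src _ _) (fun h => h.eq_of_tgt _ _))
    have h0 : Limits.IsZero P.obj := ModuleCat.isZero_of_subsingleton _
    exact ⟨fun Y => ⟨⟨⟨ObjectProperty.homMk 0⟩, fun f => key _ _ (Or.inl h0)⟩⟩,
      fun Y => ⟨⟨⟨ObjectProperty.homMk 0⟩, fun f => key _ _ (Or.inr h0)⟩⟩⟩

end iterate

/-- A sequence of morphisms of `proj(Λ)` that is exact at all positive spots and whose
differentials have image in the radical. -/
structure IsMinimalExact {Λ : Type v} [Ring Λ] (P : ℕ → FGProj Λ)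
    (f : ∀ n, P (n + 1) ⟶ P n) : Prop where
  exact : ∀ n, Function.Exact (FGProj.linearMap (f (n + 1))) (FGProj.linearMap (f n))
  radical : ∀ n, FactorsThroughRadicalPow 1 (f n)

/-- The `R`-module structure on a module over an `R`-algebra. -/
abbrev ModuleCat.baseModule (R : Type*) [CommRing R] {Λ : Type*} [Ring Λ] [Algebra R Λ]
    (M : ModuleCat.{v} Λ) : Module R M := Module.restrictScalars R Λ M

theorem ModuleCat.isScalarTower_baseModule (R : Type*) [CommRing R] {Λ : Type*} [Ring Λ]
    [Algebra R Λ] (M : ModuleCat.{v} Λ) :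
    letI := ModuleCat.baseModule R M
    IsScalarTower R Λ M := IsScalarTower.restrictScalars R Λ M

/-- Apply a vanishing criterion for complexes with differentials in `𝔪 ^ c` to minimal complexes
by means of an iterate of an order-raising functor. -/
theorem IsMinimalExact.subsingleton_of_orderRaising {R : Type*} {Λ : Type v} [CommRing R]
    [IsNoetherianRing R] [IsLocalRing R] [Ring Λ] [Algebra R Λ] [Module.Finite R Λ]
    {Φ : FGProj Λ ⥤ FGProj Λ} (hexact : IsExactEndofunctor Φ) (hraise : IsOrderRaising Φ)
    (hker : HasZeroKernel Φ) {c B : ℕ}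
    (hcB : ∀ (Q : ℕ → Type v) [∀ n, AddCommGroup (Q n)] [∀ n, Module R (Q n)]
      [∀ n, Module Λ (Q n)] [∀ n, IsScalarTower R Λ (Q n)] [∀ n, Module.Projective Λ (Q n)]
      [∀ n, Module.Finite R (Q n)] (f : ∀ n, Q (n + 1) →ₗ[Λ] Q n),
      (∀ n, Function.Exact (f (n + 1)) (f n)) →
      (∀ n z, f n z ∈ (maximalIdeal R ^ c • ⊤ : Submodule R (Q n))) →
      ∀ n, B ≤ n → Subsingleton (Q n))
    {P : ℕ → FGProj Λ} {f : ∀ n, P (n + 1) ⟶ P n} (hP : IsMinimalExact P f) {n : ℕ}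
    (hn : B ≤ n) : Subsingleton (P n).obj := by
  -- `c` determines `i` and then `e`; neither depends on the complex.
  obtain ⟨i, hi0, hi⟩ := exists_jacobson_pow_le_pow_smulTop R (Λ := Λ) c
  obtain ⟨e, -, he⟩ := hraise i hi0
  let Q : ℕ → FGProj Λ := fun n => (functorIterate Φ e).obj (P n)
  let _ : ∀ n, Module R (Q n).obj := fun n => ModuleCat.baseModule R (Q n).obj
  have _ : ∀ n, IsScalarTower R Λ (Q n).obj := fun n =>
    ModuleCat.isScalarTower_baseModule R (Q n).obj
  have _ : ∀ n, Module.Projective Λ (Q n).obj := fun n => (Q n).property.2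
  have _ : ∀ n, Module.Finite Λ (Q n).obj := fun n => (Q n).property.1
  have _ : ∀ n, Module.Finite R (Q n).obj := fun n => Module.Finite.trans Λ (Q n).obj
  have hQ := hcB (fun n => (Q n).obj) (fun n => FGProj.linearMap ((functorIterate Φ e).map (f n)))
    (fun n => hexact.iterate e _ _ (hP.exact n))
    (fun n z => mem_smul_top_of_mem_jacobson_pow_smul_top hi
      (he e le_rfl (f n) (hP.radical n) ⟨z, rfl⟩)) n hn
  rw [← FGProj.isZero_iff_subsingleton] at hQ ⊢
  exact hker.iterate e _ hQ

/-! ### Minimal projective resolutions -/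

theorem ModuleCat.exists_projectiveCover (R : Type*) {Λ : Type v} [CommRing R] [IsNoetherianRing R] [IsLocalRing R]
    [IsAdicComplete (maximalIdeal R) R] [Ring Λ] [Algebra R Λ] [Module.Finite R Λ] (M : ModuleCat.{v} Λ) [Module.Finite Λ M] :
    ∃ (P : FGProj Λ) (g : P.obj →ₗ[Λ] M), Function.Surjective g ∧
      LinearMap.ker g ≤ Ring.jacobson Λ • ⊤ := by
  let _ := ModuleCat.baseModule R M
  have := ModuleCat.isScalarTower_baseModule R M
  obtain ⟨n, C, g, hproj, hg, hk⟩ := _root_.exists_projectiveCover R (Λ := Λ) M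
  exact ⟨⟨ModuleCat.of Λ ((Fin n → Λ) ⧸ C), inferInstanceAs (Module.Finite Λ _), hproj⟩, g, hg, hk⟩

/-- Finitely generated modules have minimal projective resolutions; hence a uniform bound on the
length of minimal complexes bounds the projective dimensions. -/
theorem hasProjectiveDimensionLT_of_isMinimalExact (R : Type*) {Λ : Type v} [CommRing R] [IsNoetherianRing R] [IsLocalRing R]
    [IsAdicComplete (maximalIdeal R) R] [Ring Λ] [Algebra R Λ] [Module.Finite R Λ] {B : ℕ}
    (hB : ∀ (P : ℕ → FGProj Λ) (f : ∀ n, P (n + 1) ⟶ P n), IsMinimalExact P f →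
      Subsingleton (P B).obj) (M : ModuleCat.{v} Λ) [hM : Module.Finite Λ M] :
    HasProjectiveDimensionLT M B := by
  have : IsNoetherianRing Λ := isNoetherian_of_tower R inferInstance
  choose P g hg hker using fun N : {N : ModuleCat.{v} Λ // Module.Finite Λ N} =>
    have := N.2
    ModuleCat.exists_projectiveCover R N.1
  let next : {N : ModuleCat.{v} Λ // Module.Finite Λ N} → {N : ModuleCat.{v} Λ // Module.Finite Λ N} :=
    fun N => ⟨ModuleCat.of Λ (LinearMap.ker (g N)), by
      have := (P N).property.1
      exact inferInstanceAs (Module.Finite Λ (LinearMap.ker (g N)))⟩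
  let S : ℕ → {N : ModuleCat.{v} Λ // Module.Finite Λ N} := fun n => Nat.rec ⟨M, hM⟩ (fun _ N => next N) n
  let f : ∀ n, P (S (n + 1)) ⟶ P (S n) := fun n =>
    ObjectProperty.homMk (ModuleCat.ofHom ((LinearMap.ker (g (S n))).subtype.comp (g (S (n + 1)))))
  have hf : ∀ n z, FGProj.linearMap (f n) z = (g (S (n + 1)) z : LinearMap.ker (g (S n))).1 :=
    fun n z => rfl
  have hmin : IsMinimalExact (fun n => P (S n)) f := by
    refine ⟨fun n z => ?_, fun n => ?_⟩
    · rw [hf]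
      constructor
      · intro hz
        obtain ⟨w, hw⟩ := hg (S (n + 2)) ⟨z, Subtype.ext hz⟩
        exact ⟨w, congrArg Subtype.val hw⟩
      · rintro ⟨w, rfl⟩
        exact congrArg Subtype.val (g (S (n + 2)) w : LinearMap.ker (g (S (n + 1)))).2
    · rintro _ ⟨z, rfl⟩
      rw [Submodule.pow_one]
      exact hker (S n) (g (S (n + 1)) z : LinearMap.ker (g (S n))).2
  have hPB := hB (fun n => P (S n)) f hmin
  -- `S n` is the `n`-th syzygy. `S B` is a quotient of the zero module `P (S B)`; descending to `S
  -- 0 = M`, each cover raises the bound by one.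
  have key : ∀ k ≤ B, HasProjectiveDimensionLT (S (B - k)).1 k := by
    intro k
    induction k with
    | zero =>
      intro _
      have : Subsingleton (S B).1 := (hg (S B)).subsingleton
      exact (ModuleCat.isZero_of_subsingleton (S B).1).hasProjectiveDimensionLT_zero
    | succ k ih =>
      intro hk
      have h1 := ih (by omega)
      obtain ⟨l, hl⟩ : ∃ l, l = B - (k + 1) := ⟨_, rfl⟩
      have hl' : B - k = l + 1 := by omega
      rw [hl'] at h1
      rw [← hl]
      have hS : (LinearMap.shortComplexKer (g (S l))).ShortExact :=
        LinearMap.shortExact_shortComplexKer (hg (S l))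
      have hproj : Projective (P (S l)).obj := by
        rw [← IsProjective.iff_projective]
        exact (P (S l)).property.2
      exact hS.hasProjectiveDimensionLT_X₃ k h1
        (hasProjectiveDimensionLT_of_ge (P (S l)).obj 1 (k + 1) (by omega))
  have := key B le_rfl
  rwa [Nat.sub_self] at this

/-! ### Reduction of global dimension to finitely generated modules -/

section gldim

variable {Λ : Type v} [Ring Λ]

/-- Baer's criterion: the obstruction to extending a map `I → X` to `Λ` lies in `Ext¹(Λ / I, X)`. -/
theorem injective_of_forall_finite_ext_one (X : ModuleCat.{v} Λ)
    (h : ∀ M : ModuleCat.{v} Λ, Module.Finite Λ M → Subsingleton (Ext M X 1)) : Injective X := by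
  have hB : Module.Baer Λ X := fun I g => by
    have hS := LinearMap.shortExact_shortComplexKer (M := ModuleCat.of Λ Λ)
      (N := ModuleCat.of Λ (Λ ⧸ I)) (f := I.mkQ) I.mkQ_surjective
    have hsub := h (ModuleCat.of Λ (Λ ⧸ I)) (inferInstanceAs (Module.Finite Λ (Λ ⧸ I)))
    have hker : ∀ x ∈ LinearMap.ker I.mkQ, x ∈ I := fun x hx => by simpa using hx
    let g' : LinearMap.ker I.mkQ →ₗ[Λ] X := g.comp (Submodule.inclusion hker)
    obtain ⟨y, hy⟩ := Ext.contravariant_sequence_exact₁ hS X (Ext.mk₀ (ModuleCat.ofHom g')) rfl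
      (Subsingleton.elim _ _)
    obtain ⟨f, rfl⟩ := (Ext.mk₀_bijective _ _).2 y
    rw [Ext.mk₀_comp_mk₀, (Ext.mk₀_bijective _ _).1.eq_iff] at hy
    refine ⟨f.hom, fun x hx => ?_⟩
    exact congrArg (fun k : ModuleCat.of Λ (LinearMap.ker I.mkQ) ⟶ X => k.hom ⟨x, by simpa using hx⟩) hy
  have := Module.Baer.injective hB
  exact Module.injective_object_of_injective_module Λ X

theorem hasInjectiveDimensionLT_of_forall_finite (n : ℕ) (X : ModuleCat.{v} Λ)
    (h : ∀ M : ModuleCat.{v} Λ, Module.Finite Λ M → Subsingleton (Ext M X (n + 1))) :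
    HasInjectiveDimensionLT X (n + 1) := by
  induction n generalizing X with
  | zero =>
    have := injective_of_forall_finite_ext_one X h
    infer_instance
  | succ n ih =>
    let ⟨I, _, f, _⟩ := EnoughInjectives.presentation X
    let S : ShortComplex (ModuleCat.{v} Λ) := ShortComplex.mk f (Limits.cokernel.π f) (by simp)
    have hS : S.ShortExact :=
      { exact := ShortComplex.exact_of_g_is_cokernel _ (Limits.cokernelIsCokernel f) }
    refine (hS.hasInjectiveDimensionLT_X₃_iff n inferInstance).mp (ih S.X₃ fun M hM => ?_)
    refine ⟨fun a b => sub_eq_zero.mp ?_⟩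
    have := h M hM
    obtain ⟨y, hy⟩ := Ext.covariant_sequence_exact₃ M hS (a - b) rfl (Subsingleton.elim _ _)
    have : y = 0 := Ext.eq_zero_of_injective y
    rw [← hy, this, Ext.zero_comp]

/-- The global dimension is detected on finitely generated modules. -/
theorem globalDimension_le_of_forall_finite (n : ℕ)
    (h : ∀ M : ModuleCat.{v} Λ, Module.Finite Λ M → HasProjectiveDimensionLT M (n + 1)) :
    globalDimension Λ ≤ n := by
  refine iSup_le fun M => ?_
  rw [projectiveDimension_le_iff]
  refine HasProjectiveDimensionLT.mk fun i hi Y e => ?_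
  -- Bounding the injective dimension of the second argument removes the finiteness condition on the
  -- first.
  have : HasInjectiveDimensionLT Y (n + 1) := hasInjectiveDimensionLT_of_forall_finite n Y
    fun M hM => have := h M hM; HasProjectiveDimensionLT.subsingleton M (n + 1) _ le_rfl Y
  exact e.eq_zero_of_hasInjectiveDimensionLT (n + 1) hi

end gldim

/-! ### Vanishing of Ext below the length of a regular sequence -/

section rees

variable {R : Type*} {Λ : Type v} [CommRing R] [Ring Λ] [Algebra R Λ]

/-- The `R`-linear structure on modules over an `R`-algebra. -/
abbrev ModuleCat.baseLinear (R : Type*) [CommRing R] (Λ : Type*) [Ring Λ] [Algebra R Λ] :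
    Linear R (ModuleCat.{v} Λ) :=
  letI := fun M : ModuleCat.{v} Λ => ModuleCat.baseModule R M
  haveI := fun M : ModuleCat.{v} Λ => ModuleCat.isScalarTower_baseModule R M
  { homModule := fun _ _ => inferInstance }

/-- A central element killing `N` and acting injectively on `X` allows dimension shifting for
`Ext(N, -)`. -/
theorem subsingleton_ext_of_smul {N X : ModuleCat.{v} Λ} (x : R)
    (hN : ∀ z : N, algebraMap R Λ x • z = 0) {Y : ModuleCat.{v} Λ} (μ : X ⟶ X) (g : X ⟶ Y)
    (hμ : ∀ z, μ z = algebraMap R Λ x • z) (w : μ ≫ g = 0)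
    (hS : (ShortComplex.mk μ g w).ShortExact) {k : ℕ}
    (h : ∀ i < k, Subsingleton (Ext N Y i)) (i : ℕ) (hi : i < k + 1) :
    Subsingleton (Ext N X i) := by
  let _ := ModuleCat.baseLinear R Λ
  have hμ' : μ = x • 𝟙 X := by
    ext z
    exact hμ z
  have h0 : x • 𝟙 N = 0 := by
    ext z
    exact hN z
  -- Multiplication by `x` on Ext may be computed on either argument, and it is zero on `N`.
  have hzero : ∀ α : Ext N X i, α.comp (Ext.mk₀ μ) (add_zero i) = 0 := fun α => by
    rw [hμ', Ext.mk₀_smul, Ext.comp_smul, Ext.comp_mk₀_id, ← Ext.mk₀_id_comp α, ← Ext.smul_comp,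
      ← Ext.mk₀_smul, h0, Ext.mk₀_zero, Ext.zero_comp]
  refine ⟨fun a b => sub_eq_zero.mp ?_⟩
  match i, hi with
  | 0, _ =>
    have := hS.mono_f
    exact Ext.postcomp_mk₀_injective_of_mono N μ
      ((hzero (a - b)).trans (Ext.zero_comp _ _ _ _ (add_zero 0)).symm)
  | i + 1, hi =>
    obtain ⟨y, hy⟩ := Ext.covariant_sequence_exact₁ N hS (a - b) (hzero _) rfl
    have := h i (by omega)
    rw [← hy, Subsingleton.elim y 0, Ext.zero_comp]

/-- With `k` elements still unused, `0 → P/I_s → P/I_s → P/I_{s+1} → 0` shifts dimensions: each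
element gains one degree of vanishing. -/
theorem subsingleton_ext_quotient_smulTop {P : Type v} [AddCommGroup P] [Module R P] [Module Λ P]
    [IsScalarTower R Λ P] {d : ℕ} {I : ℕ → Ideal R} {x : ℕ → R}
    (hIs : ∀ s < d, I (s + 1) = I s ⊔ Ideal.span {x s})
    (hreg : ∀ s < d, ∀ z : P, x s • z ∈ (I s • ⊤ : Submodule R P) → z ∈ (I s • ⊤ : Submodule R P))
    (N : ModuleCat.{v} Λ) (hN : ∀ s < d, ∀ z : N, algebraMap R Λ (x s) • z = 0) (k : ℕ) :
    ∀ s, s + k ≤ d → ∀ i < k, Subsingleton (Ext N (ModuleCat.of Λ (P ⧸ (I s).smulTop Λ P)) i) := by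
  induction k with
  | zero => intro _ _ i hi; omega
  | succ k ih =>
    intro s hs i hi
    have hle : (I s).smulTop Λ P ≤ (I (s + 1)).smulTop Λ P := fun z hz => by
      rw [Ideal.mem_smulTop] at hz ⊢
      rw [hIs s (by omega)]
      exact Submodule.smul_mono_left le_sup_left hz
    let μ : (P ⧸ (I s).smulTop Λ P) →ₗ[Λ] (P ⧸ (I s).smulTop Λ P) :=
      { toFun := fun z => x s • z
        map_add' := smul_add _
        map_smul' := fun a z => by
          have := IsScalarTower.to_smulCommClass (R := R) (A := Λ) (M := P ⧸ (I s).smulTop Λ P)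
          exact smul_comm _ _ _ }
    let g : (P ⧸ (I s).smulTop Λ P) →ₗ[Λ] (P ⧸ (I (s + 1)).smulTop Λ P) := Submodule.factor hle
    have hμ : Function.Injective μ := by
      rw [injective_iff_map_eq_zero]
      intro z hz
      obtain ⟨z, rfl⟩ := Submodule.mkQ_surjective _ z
      exact (Submodule.Quotient.mk_eq_zero _).mpr (hreg s (by omega) z
        ((Submodule.Quotient.mk_eq_zero _).mp hz))
    have hex : Function.Exact μ g := by
      intro z
      obtain ⟨z, rfl⟩ := Submodule.mkQ_surjective _ z
      have : g (Submodule.mkQ _ z) = 0 ↔ z ∈ ((I s ⊔ Ideal.span {x s}) • ⊤ : Submodule R P) := by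
        rw [← hIs s (by omega)]
        exact Submodule.Quotient.mk_eq_zero _
      rw [this, mem_sup_span_singleton_smul_top_iff]
      constructor
      · rintro ⟨w, hw⟩
        refine ⟨Submodule.mkQ _ w, ?_⟩
        have := (Submodule.Quotient.mk_eq_zero ((I s).smulTop Λ P)).mpr hw
        rw [Submodule.Quotient.mk_sub, sub_eq_zero] at this
        exact this.symm
      · rintro ⟨w, hw⟩
        obtain ⟨w, rfl⟩ := Submodule.mkQ_surjective _ w
        refine ⟨w, (Submodule.Quotient.mk_eq_zero ((I s).smulTop Λ P)).mp ?_⟩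
        rw [Submodule.Quotient.mk_sub, sub_eq_zero]
        exact hw.symm
    have hS := ModuleCat.shortComplex_shortExact (ShortComplex.mk (ModuleCat.ofHom μ)
      (ModuleCat.ofHom g) 
      (ModuleCat.hom_ext (LinearMap.ext hex.apply_apply_eq_zero))) hex hμ
      (Submodule.factor_surjective hle)
    exact subsingleton_ext_of_smul (x s) (hN s (by omega)) (ModuleCat.ofHom μ) (ModuleCat.ofHom g)
      (fun z => (algebraMap_smul Λ (x s) z).symm) _ hS (ih (s + 1) (by omega)) i hi

/-- If `x₀, …, x_{d-1}` is a weakly `Λ`-regular sequence of central elements that kills `N`, then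
`Ext^i(N, X) = 0` for `i + pd X < d`. -/
theorem subsingleton_ext_of_hasProjectiveDimensionLT {d : ℕ} {I : ℕ → Ideal R} {x : ℕ → R}
    (hI0 : I 0 = ⊥) (hIs : ∀ s < d, I (s + 1) = I s ⊔ Ideal.span {x s})
    (hreg : ∀ s < d, ∀ z : Λ, x s • z ∈ (I s • ⊤ : Submodule R Λ) → z ∈ (I s • ⊤ : Submodule R Λ))
    (N : ModuleCat.{v} Λ) (hN : ∀ s < d, ∀ z : N, algebraMap R Λ (x s) • z = 0) (n : ℕ) :
    ∀ (X : ModuleCat.{v} Λ), HasProjectiveDimensionLT X (n + 1) → ∀ i, i + n < d →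
      Subsingleton (Ext N X i) := by
  have hproj : ∀ (X : ModuleCat.{v} Λ), Projective X → ∀ i < d, Subsingleton (Ext N X i) := by
    intro X hX i hi
    let _ := ModuleCat.baseModule R X
    have := ModuleCat.isScalarTower_baseModule R X
    rw [← IsProjective.iff_projective] at hX
    have h := subsingleton_ext_quotient_smulTop (P := X) hIs
      (fun s hs z hz => mem_smul_top_of_smul_mem_of_projective (hreg s hs) hz) N hN d 0
      (by omega) i hi
    have hbot : (I 0).smulTop Λ X = ⊥ := by
      ext z; rw [Ideal.mem_smulTop, hI0, Submodule.bot_smul]; rfl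
    let e : X ≅ ModuleCat.of Λ (X ⧸ (I 0).smulTop Λ X) :=
      (Submodule.quotEquivOfEqBot _ hbot).symm.toModuleIso
    refine ⟨fun a b => ?_⟩
    have key : ∀ α : Ext N X i,
        α = (α.comp (Ext.mk₀ e.hom) (add_zero i)).comp (Ext.mk₀ e.inv) (add_zero i) := fun α => by
      rw [Ext.comp_assoc_of_third_deg_zero, Ext.mk₀_comp_mk₀, e.hom_inv_id, Ext.comp_mk₀_id]
    rw [key a, key b, Subsingleton.elim (a.comp _ _) (b.comp _ _)]
  induction n with
  | zero =>
    intro X hX i hi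
    exact hproj X (projective_iff_hasProjectiveDimensionLT_one.mpr hX) i hi
  | succ n ih =>
    intro X hX i hi
    -- For a syzygy `K` of `X`, `Ext^i(N, X)` sits between `Ext^i` into a projective and
    -- `Ext^(i+1)(N, K)`, both zero.
    have hS := ModuleCat.shortExact_projectiveShortComplex X
    have hK := (hS.hasProjectiveDimensionLT_X₃_iff n inferInstance).mp hX
    have h1 := ih _ hK (i + 1) (by omega)
    have h2 := hproj X.projectiveShortComplex.X₂ inferInstance i (by omega)
    refine ⟨fun a b => sub_eq_zero.mp ?_⟩
    obtain ⟨y, hy⟩ := Ext.covariant_sequence_exact₃ N hS (a - b) rfl (Subsingleton.elim _ _)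
    rw [← hy, Subsingleton.elim y 0, Ext.zero_comp]

end rees

/-! ### The Cohen–Macaulay case and the conclusion -/

theorem exists_pow_smul_top_le_of_isRegular {R N : Type*} [CommRing R] [IsNoetherianRing R]
    [IsLocalRing R] [AddCommGroup N] [Module R N] [Module.Finite R N] {rs : List R}
    (hrs : RingTheory.Sequence.IsRegular N rs)
    (hlen : ((rs.length : ℕ∞) : WithBot ℕ∞) = ringKrullDim R) :
    ∃ c, (maximalIdeal R ^ c • ⊤ : Submodule R N) ≤ Ideal.ofList rs • ⊤ := by
  set U : Submodule R N := Ideal.ofList rs • ⊤ with hU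
  have hnt : Nontrivial (N ⧸ U) :=
    Submodule.Quotient.nontrivial_iff.mpr (Ne.symm hrs.top_ne_smul)
  -- Each regular element lowers the dimension by one, so `N / U` has dimension zero: its support is
  -- `{𝔪}`, and a power of `𝔪` kills it.
  have hdim := Module.supportDim_add_length_eq_supportDim_of_isRegular rs hrs
  have hle : Module.supportDim R N ≤ ringKrullDim R := Module.supportDim_le_ringKrullDim R N
  have h0 : Module.supportDim R (N ⧸ U) = 0 := by
    have h1 : Module.supportDim R (N ⧸ U) ≠ ⊥ := Module.supportDim_ne_bot_of_nontrivial R _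
    rw [← hdim, ← hlen, ← hU] at hle
    refine le_antisymm (ENat.WithBot.add_le_add_natCast_right_iff (c := rs.length).mp ?_) ?_
    · rw [zero_add]
      exact hle
    · generalize Module.supportDim R (N ⧸ U) = a at h1
      cases a with
      | bot => exact absurd rfl h1
      | coe a => exact WithBot.coe_le_coe.mpr zero_le
  have hsupp := support_of_supportDim_eq_zero R (N ⧸ U) h0
  rw [Module.support_eq_zeroLocus] at hsupp
  have hrad : maximalIdeal R ≤ (Module.annihilator R (N ⧸ U)).radical := by
    rw [PrimeSpectrum.zeroLocus_eq_iff.mp hsupp]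
    exact Ideal.le_radical
  obtain ⟨c, hc⟩ := Ideal.exists_pow_le_of_le_radical_of_fg hrad (IsNoetherian.noetherian _)
  refine ⟨c, Submodule.smul_le.mpr fun r hr z _ => ?_⟩
  have := Module.mem_annihilator.mp (hc hr) (Submodule.Quotient.mk z)
  rwa [← Submodule.Quotient.mk_smul, Submodule.Quotient.mk_eq_zero] at this

theorem Ideal.ofList_take_succ {R : Type*} [CommSemiring R] (rs : List R) {s : ℕ} (hs : s < rs.length) :
    Ideal.ofList (rs.take (s + 1)) = Ideal.ofList (rs.take s) ⊔ Ideal.span {rs.getD s 0} := by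
  rw [List.take_succ_eq_append_getElem hs, Ideal.ofList_append, Ideal.ofList_singleton,
    List.getD_eq_getElem _ _ hs]

theorem globalDimension_lt_top_of_orderRaising (R : Type u) {Λ : Type v} [CommRing R] [IsNoetherianRing R] [IsLocalRing R]
    [IsAdicComplete (maximalIdeal R) R] [Ring Λ] [Algebra R Λ] [Module.Finite R Λ]
    {Φ : FGProj Λ ⥤ FGProj Λ}
    (hexact : IsExactEndofunctor Φ)
    (hraise : IsOrderRaising Φ) (hker : HasZeroKernel Φ) : globalDimension Λ < ⊤ := by
  obtain ⟨c, B, hcB⟩ := exists_uniform_vanishing.{v} R Λ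
  refine (globalDimension_le_of_forall_finite B fun M _ => ?_).trans_lt
    (WithBot.coe_lt_coe.mpr (ENat.natCast_lt_top B))
  exact hasProjectiveDimensionLT_of_isMinimalExact R (fun P f hP =>
    hP.subsingleton_of_orderRaising hexact hraise hker hcB (Nat.le_succ B)) M

theorem globalDimension_eq_of_isRegular {R : Type u} {Λ : Type v} [CommRing R] [IsNoetherianRing R] [IsLocalRing R]
    [IsAdicComplete (maximalIdeal R) R] [Ring Λ] [Algebra R Λ] [Module.Finite R Λ]
    {Φ : FGProj Λ ⥤ FGProj Λ}
    (hexact : IsExactEndofunctor Φ)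
    (hraise : IsOrderRaising Φ) (hker : HasZeroKernel Φ) {rs : List R}
    (hm : ∀ r ∈ rs, r ∈ maximalIdeal R) (hrs : RingTheory.Sequence.IsRegular Λ rs)
    (hlen : ((rs.length : ℕ∞) : WithBot ℕ∞) = ringKrullDim R) :
    globalDimension Λ = (rs.length : ℕ∞) := by
  let I : ℕ → Ideal R := fun s => Ideal.ofList (rs.take s)
  have hI0 : I 0 = ⊥ := by simp [I]
  have hIs : ∀ s < rs.length, I (s + 1) = I s ⊔ Ideal.span {rs.getD s 0} :=
    fun s hs => Ideal.ofList_take_succ rs hs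
  have hId : I rs.length = Ideal.ofList rs := by simp [I]
  have hIm : I rs.length ≤ maximalIdeal R := by
    rw [hId]
    exact Ideal.span_le.mpr fun r hr => hm r hr
  have hreg : ∀ s < rs.length, ∀ z : Λ, rs.getD s 0 • z ∈ (I s • ⊤ : Submodule R Λ) →
      z ∈ (I s • ⊤ : Submodule R Λ) := by
    intro s hs z hz
    have h := hrs.regular_mod_prev s hs
    rw [List.getD_eq_getElem _ _ hs] at hz
    rw [← Submodule.Quotient.mk_eq_zero] at hz ⊢
    rw [Submodule.Quotient.mk_smul] at hz
    exact h.right_eq_zero_of_smul hz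
  apply le_antisymm
  · obtain ⟨c, hc⟩ := exists_pow_smul_top_le_of_isRegular hrs hlen
    rw [← hId] at hc
    have hcB : ∀ (Q : ℕ → Type v) [∀ n, AddCommGroup (Q n)] [∀ n, Module R (Q n)]
        [∀ n, Module Λ (Q n)] [∀ n, IsScalarTower R Λ (Q n)] [∀ n, Module.Projective Λ (Q n)]
        [∀ n, Module.Finite R (Q n)] (f : ∀ n, Q (n + 1) →ₗ[Λ] Q n),
        (∀ n, Function.Exact (f (n + 1)) (f n)) →
        (∀ n z, f n z ∈ (maximalIdeal R ^ c • ⊤ : Submodule R (Q n))) →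
        ∀ n, rs.length + 1 ≤ n → Subsingleton (Q n) := by
      intro Q _ _ _ _ _ _ f hf hfc n hn
      exact subsingleton_of_regular_of_pow_le hI0 hIs hIm hreg hc f hf hfc n hn
    refine globalDimension_le_of_forall_finite rs.length fun M _ => ?_
    exact hasProjectiveDimensionLT_of_isMinimalExact R (fun P f hP =>
      hP.subsingleton_of_orderRaising hexact hraise hker hcB le_rfl) M
  · let N : ModuleCat.{v} Λ := ModuleCat.of Λ (Λ ⧸ (Ideal.ofList rs).smulTop Λ Λ)
    have hN : ∀ s < rs.length, ∀ z : N, algebraMap R Λ (rs.getD s 0) • z = 0 := by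
      intro s hs z
      obtain ⟨z, rfl⟩ := Submodule.mkQ_surjective ((Ideal.ofList rs).smulTop Λ Λ) z
      have hmem : rs.getD s 0 ∈ Ideal.ofList rs := by
        rw [List.getD_eq_getElem _ _ hs]
        exact Ideal.subset_span (List.getElem_mem hs)
      have hz : algebraMap R Λ (rs.getD s 0) • z ∈ (Ideal.ofList rs).smulTop Λ Λ := by
        rw [algebraMap_smul, Ideal.mem_smulTop]
        exact Submodule.smul_mem_smul hmem trivial
      exact (Submodule.Quotient.mk_eq_zero _).mpr hz
    have hN0 : ¬ Limits.IsZero N := by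
      intro h
      rw [ModuleCat.isZero_iff_subsingleton] at h
      refine hrs.top_ne_smul (Eq.symm (eq_top_iff.mpr fun z _ => ?_))
      have hz : ((Ideal.ofList rs).smulTop Λ Λ).mkQ z = 0 := Subsingleton.elim (α := N) _ _
      exact (Submodule.Quotient.mk_eq_zero _).mp hz
    refine le_trans ?_ (le_iSup (fun M : ModuleCat.{v} Λ => projectiveDimension M) N)
    by_contra hlt
    rw [not_le] at hlt
    have hpd : HasProjectiveDimensionLT N rs.length := projectiveDimension_lt_iff.mp hlt
    obtain hd | ⟨n, hd⟩ : rs.length = 0 ∨ ∃ n, rs.length = n + 1 := by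
      cases rs.length <;> simp
    · rw [hd] at hpd
      exact hN0 (isZero_of_hasProjectiveDimensionLT_zero N)
    · rw [hd] at hpd
      -- Taking `X = N` and `i = 0` gives `Hom(N, N) = 0`, which is absurd for nonzero `N`.
      have := subsingleton_ext_of_hasProjectiveDimensionLT hI0 hIs hreg N hN n N hpd 0 (by omega)
      have h1 : Subsingleton (N ⟶ N) := Ext.homEquiv₀.subsingleton_congr.mp this
      exact hN0 ((Limits.IsZero.iff_id_eq_zero N).mpr (Subsingleton.elim _ _))

theorem mainTheorem8 (R : Type u) [CommRing R] [IsDomain R] [IsNoetherianRing R] [IsLocalRing R]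
    [IsAdicComplete (IsLocalRing.maximalIdeal R) R]
    (d : ℕ) (hd : ringKrullDim R = d)
    (Λ : Type v) [Ring Λ] [Algebra R Λ] [Module.Finite R Λ] [Module.IsTorsionFree R Λ]
    (Φ : FGProj Λ ⥤ FGProj Λ) (hexact : IsExactEndofunctor Φ)
    (hraise : IsOrderRaising Φ) (hker : HasZeroKernel Φ) :
    globalDimension Λ < ⊤ ∧
      (IsMaximalCohenMacaulay R Λ → globalDimension Λ = d) := by
  refine ⟨globalDimension_lt_top_of_orderRaising R hexact hraise hker, ?_⟩
  rintro ⟨rs, hm, hrs, hlen⟩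
  rw [globalDimension_eq_of_isRegular hexact hraise hker hm hrs hlen, hlen, hd]
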